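/- A field of algebraic numbers is an algebraic, possibly infinite, extension $K$ of $\mathbb Q$, and $\mathcal O_K$ denotes its ring of algebraic integers. Call $K$ *big* if for every positive integer $n$ it contains a number field $F$ with $n \mid [F:\mathbb Q]$ (equivalently, $[K:\mathbb Q]=\prod_p p^\infty$ as a supernatural number). 1. There are an integer $r\ge 1$ and a single polynomial $P(w,a,b,x_1,\dots,x_r)$ with coefficients in $\mathbb Z$ such that for every non-big field $K$ of algebraic numbers $$\{\,w\in\mathcal O_K : \forall a\in\mathcal O_K\ \forall b\in\mathcal O_K\ \exists x_1,\dots,x_r\in\mathcal O_K\quad P(w,a,b,x_1,\dots,x_r)=0\,\}=\mathbb Z .$$ That is, one parameter-free first-order formula of the form $\forall\forall\exists\cdots\exists$ in the language of rings defines $\mathbb Z$ in $\mathcal O_K$ for all non-big $K$ at once. 2. Every number field is non-big, so this applies to all number fields. 3. For every non-big field $K$ of algebraic numbers the first-order theory of $\mathcal O_K$ in the language of rings is undecidable: no algorithm decides, given a sentence, whether it is true in $\mathcal O_K$. 4. The undecidability is uniform: there are a computable sequence of sentences $\theta_0,\theta_1,\dots$ in the language of rings and a non-computable set $H\subseteq\mathbb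 N$ such that, for every non-big field $K$ of algebraic numbers and every $n$, the sentence $\theta_n$ is true in $\mathcal O_K$ if and only if $n\in H$. -/

import Mathlib

open FirstOrder

universe u

/-- A field `K` of algebraic numbers is *big* if for every positive integer `n` it contains a
number field whose degree over `ℚ` is divisible by `n`; that is, if `[K : ℚ]`, as a supernatural
number, is the product of `p ^ ∞` over all primes `p`. -/
def IsBigField (K : Type u) [Field K] [CharZero K] : Prop :=
  ∀ n : ℕ, 0 < n →
    ∃ F : IntermediateField ℚ K, FiniteDimensional ℚ F ∧ n ∣ Module.finrank ℚ F

/-- Prefix a block of `r` existential quantifiers. -/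
def exBlock {L : Language} {α : Type} {n : ℕ} :
    (r : ℕ) → L.BoundedFormula α (n + r) → L.BoundedFormula α n
  | 0, φ => φ
  | r + 1, φ => exBlock r φ.ex

/-- A formula in the language of rings with one free variable has the form `∀∀∃…∃` if it is
`∀ a, ∀ b, ∃ x₁, …, ∃ xᵣ, t₁ = t₂` with `r ≥ 1`, where `t₁` and `t₂` are terms in the free
variable and in `a, b, x₁, …, xᵣ`. Since terms are polynomial expressions with integer
coefficients, the matrix is a single polynomial equation `P = 0` over `ℤ`. -/
def IsForallForallExists (φ : Language.ring.Formula (Fin 1)) : Prop :=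
  ∃ r : ℕ, 1 ≤ r ∧ ∃ t₁ t₂ : Language.ring.Term (Fin 1 ⊕ Fin (2 + r)),
    φ = (exBlock r (t₁.bdEqual t₂)).all.all

/-- The subset of a ring defined by a formula (without parameters) with one free variable. -/
def ringDefinedSet (R : Type u) [CommRing R] (φ : Language.ring.Formula (Fin 1)) : Set R :=
  letI := Ring.compatibleRingOfRing R
  {w : R | φ.Realize fun _ => w}

/-- The first-order theory of a ring: the set of all sentences in the language of rings that
are true in it. -/
def ringTheory (R : Type u) [CommRing R] : Set Language.ring.Sentence :=
  letI := Ring.compatibleRingOfRing R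
  Language.ring.completeTheory R

/-- Gödel numbers of terms in the language of rings. -/
def ringTermCode {n : ℕ} : Language.ring.Term (Empty ⊕ Fin n) → ℕ
  | .var (.inl e) => e.elim
  | .var (.inr i) => Nat.pair 0 i
  | .func ringFunc.add ts => Nat.pair 1 (Nat.pair (ringTermCode (ts 0)) (ringTermCode (ts 1)))
  | .func ringFunc.mul ts => Nat.pair 2 (Nat.pair (ringTermCode (ts 0)) (ringTermCode (ts 1)))
  | .func ringFunc.neg ts => Nat.pair 3 (ringTermCode (ts 0))
  | .func ringFunc.zero _ => Nat.pair 4 0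
  | .func ringFunc.one _ => Nat.pair 5 0

/-- Gödel numbers of formulas in the language of rings, all of whose variables are de Bruijn
levels (the language has no relation symbols besides equality). -/
def ringFormulaCode : {n : ℕ} → Language.ring.BoundedFormula Empty n → ℕ
  | _, .falsum => Nat.pair 0 0
  | _, .equal t₁ t₂ => Nat.pair 1 (Nat.pair (ringTermCode t₁) (ringTermCode t₂))
  | _, .rel R _ => Empty.elim R
  | _, .imp φ ψ => Nat.pair 2 (Nat.pair (ringFormulaCode φ) (ringFormulaCode ψ))
  | _, .all φ => Nat.pair 3 (ringFormulaCode φ)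

theorem ringTermCode_injective {n : ℕ} :
    Function.Injective (ringTermCode (n := n)) := by
  intro s
  induction s with
  | var a =>
    rcases a with e | i
    · exact e.elim
    intro t h
    rcases t with (e | j) | ⟨g, us⟩
    · exact e.elim
    · simp only [ringTermCode, Nat.pair_eq_pair, true_and] at h
      rw [Fin.ext h]
    · cases g <;> simp [ringTermCode, Nat.pair_eq_pair] at h
  | func f ts ih =>
    intro t h
    rcases t with (e | j) | ⟨g, us⟩
    · exact e.elim
    · cases f <;> simp [ringTermCode, Nat.pair_eq_pair] at h
    · cases f <;> cases g <;> simp [ringTermCode, Nat.pair_eq_pair] at h <;>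
        congr 1 <;> funext i <;> fin_cases i
      · exact ih _ h.1
      · exact ih _ h.2
      · exact ih _ h.1
      · exact ih _ h.2
      · exact ih _ h

/-- Distinct formulas have distinct Gödel numbers. -/
theorem ringFormulaCode_injective {n : ℕ} :
    Function.Injective (ringFormulaCode (n := n)) := by
  intro φ
  induction φ with
  | falsum =>
    intro ψ h
    cases ψ with
    | rel R _ => exact Empty.elim R
    | _ => simp_all [ringFormulaCode, Nat.pair_eq_pair]
  | equal t₁ t₂ =>
    intro ψ h
    cases ψ with
    | rel R _ => exact Empty.elim R
    | equal s₁ s₂ =>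
      simp only [ringFormulaCode, Nat.pair_eq_pair, true_and] at h
      rw [ringTermCode_injective h.1, ringTermCode_injective h.2]
    | _ => simp_all [ringFormulaCode, Nat.pair_eq_pair]
  | rel R _ => exact Empty.elim R
  | imp φ₁ φ₂ ih₁ ih₂ =>
    intro ψ h
    cases ψ with
    | rel R _ => exact Empty.elim R
    | imp ψ₁ ψ₂ =>
      simp only [ringFormulaCode, Nat.pair_eq_pair, true_and] at h
      rw [ih₁ h.1, ih₂ h.2]
    | _ => simp_all [ringFormulaCode, Nat.pair_eq_pair]
  | all φ ih =>
    intro ψ h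
    cases ψ with
    | rel R _ => exact Empty.elim R
    | all ψ =>
      simp only [ringFormulaCode, Nat.pair_eq_pair, true_and] at h
      rw [ih h]
    | _ => simp_all [ringFormulaCode, Nat.pair_eq_pair]

/-- A set of sentences is decidable if an algorithm decides, given the Gödel number of a
sentence, whether the sentence belongs to the set. -/
def IsDecidableTheory (T : Set Language.ring.Sentence) : Prop :=
  ∃ p : ℕ → Prop, ComputablePred p ∧
    ∀ ψ : Language.ring.Sentence, p (ringFormulaCode ψ) ↔ ψ ∈ T

/-! Write `a = t + t⁻¹`. Solutions of `X² - a X Y + Y² = 1` correspond to units `Y t - X` of norm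
one, and `a - 2 = t⁻¹ (t - 1)²`. The defining formula thus asks, for every `a`, for such a unit
congruent to `1 + w (t - 1)` modulo `(t - 1)²`. For an integer `w = m` the unit `t ^ m` serves
(`exists_pellCongruence_intCast`).

Conversely, let `w` satisfy the formula and have degree `n ≥ 2`, and put `F = ℚ(w)`. Non-bigness
gives a prime power `p ^ e` dividing no degree of a number field inside `K`. A solution generates a
finite extension `E / F`; multiplying its conjugates over `F` brings the unit down to a fixed field
`L ∋ t`, at the price of replacing `w` by `[E : F] w`, where `p ^ e ∤ [E : F]`
(`exists_unit_of_pellCongruence`). Starting from a unit `1 + P b` with `P = p ^ j` and iterating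
gives units `1 + P M_i w ^ i b` modulo `P²`, with the `p`-adic valuations of the `M_i` bounded
independently of `j`. If the unit rank of `L` is less than `n`, those with `i < n` satisfy a
multiplicative relation with coprime exponents. Modulo `P²` it becomes a linear relation modulo `P`
among the independent powers of `w`, which for large `j` forces `p` to divide all exponents
(`false_of_units_one_add_mul`). A suitable `L` is `F` itself or, when `F` is imaginary quadratic,
`F(√5)`.

Undecidability follows because one formula for `ℤ` yields one formula for `ℕ`, and then one formula
for the halting problem, via Gödel's `β` function (`uniformlyDefinable_graph_of_partrec`). -/

/-! ### Arithmetic inside rings with a definable copy of `ℕ` -/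

/-- Given a formula `ν`, a relation on natural numbers is uniformly definable if one formula
defines it in all rings of characteristic zero in which `ν` defines `ℕ`. -/
def UniformlyDefinable (ν : Language.ring.Formula (Fin 1)) {α : Type} (D : (α → ℕ) → Prop) :
    Prop :=
  ∃ ψ : Language.ring.Formula α, ∀ (R : Type u) [CommRing R] [CharZero R],
    ringDefinedSet R ν = Set.range (Nat.cast : ℕ → R) →
      letI := Ring.compatibleRingOfRing R
      ∀ v : α → ℕ, ψ.Realize (fun i => (v i : R)) ↔ D v

/-- A function on natural numbers given by a term in the language of rings. -/
def IsTermFun {α : Type} (p : (α → ℕ) → ℕ) : Prop :=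
  ∃ t : Language.ring.Term α, ∀ (R : Type u) [CommRing R],
    letI := Ring.compatibleRingOfRing R
    ∀ v : α → ℕ, t.realize (fun i => (v i : R)) = (p v : R)

namespace IsTermFun

variable {α β : Type} {p q : (α → ℕ) → ℕ}

theorem var (i : α) : IsTermFun.{u} (fun v : α → ℕ => v i) :=
  ⟨Language.Term.var i, fun _ _ _ => rfl⟩

theorem zero : IsTermFun.{u} (fun _ : α → ℕ => 0) :=
  ⟨0, fun R _ => by
    let _ := Ring.compatibleRingOfRing R
    intro v; simp⟩

theorem one : IsTermFun.{u} (fun _ : α → ℕ => 1) :=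
  ⟨1, fun R _ => by
    let _ := Ring.compatibleRingOfRing R
    intro v; simp⟩

theorem add (hp : IsTermFun.{u} p) (hq : IsTermFun.{u} q) :
    IsTermFun.{u} (fun v => p v + q v) := by
  obtain ⟨s, hs⟩ := hp
  obtain ⟨t, ht⟩ := hq
  refine ⟨s + t, fun R _ => ?_⟩
  let _ := Ring.compatibleRingOfRing R
  intro v
  rw [Ring.realize_add, hs R v, ht R v, Nat.cast_add]

theorem mul (hp : IsTermFun.{u} p) (hq : IsTermFun.{u} q) :
    IsTermFun.{u} (fun v => p v * q v) := by
  obtain ⟨s, hs⟩ := hp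
  obtain ⟨t, ht⟩ := hq
  refine ⟨s * t, fun R _ => ?_⟩
  let _ := Ring.compatibleRingOfRing R
  intro v
  rw [Ring.realize_mul, hs R v, ht R v, Nat.cast_mul]

theorem relabel (g : α → β) (hp : IsTermFun.{u} p) :
    IsTermFun.{u} (fun v : β → ℕ => p (fun i => v (g i))) := by
  obtain ⟨t, ht⟩ := hp
  refine ⟨t.relabel g, fun R _ => ?_⟩
  let _ := Ring.compatibleRingOfRing R
  intro v
  rw [Language.Term.realize_relabel]
  exact ht R fun i => v (g i)

theorem weaken (hp : IsTermFun.{u} p) :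
    IsTermFun.{u} (fun v : Option α → ℕ => p (fun i => v (some i))) :=
  hp.relabel some

end IsTermFun

namespace UniformlyDefinable

variable {ν : Language.ring.Formula (Fin 1)} {α : Type} {D E : (α → ℕ) → Prop}
  {p q r s t : (α → ℕ) → ℕ}

theorem congr (hD : UniformlyDefinable.{u} ν D) (h : ∀ v, E v ↔ D v) :
    UniformlyDefinable.{u} ν E := by
  rwa [show E = D from funext fun v => propext (h v)]

theorem eq (hp : IsTermFun.{u} p) (hq : IsTermFun.{u} q) :
    UniformlyDefinable.{u} ν (fun v => p v = q v) := by
  obtain ⟨s, hs⟩ := hp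
  obtain ⟨t, ht⟩ := hq
  refine ⟨s.equal t, fun R _ _ _ => ?_⟩
  let _ := Ring.compatibleRingOfRing R
  intro v
  rw [Language.Formula.realize_equal, hs R v, ht R v, Nat.cast_inj]

theorem not (hD : UniformlyDefinable.{u} ν D) : UniformlyDefinable.{u} ν (fun v => ¬ D v) := by
  obtain ⟨φ, hφ⟩ := hD
  refine ⟨φ.not, fun R _ _ hR => ?_⟩
  let _ := Ring.compatibleRingOfRing R
  intro v
  rw [Language.Formula.realize_not, hφ R hR v]

theorem and (hD : UniformlyDefinable.{u} ν D) (hE : UniformlyDefinable.{u} ν E) :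
    UniformlyDefinable.{u} ν (fun v => D v ∧ E v) := by
  obtain ⟨φ, hφ⟩ := hD
  obtain ⟨ψ, hψ⟩ := hE
  refine ⟨φ ⊓ ψ, fun R _ _ hR => ?_⟩
  let _ := Ring.compatibleRingOfRing R
  intro v
  rw [Language.Formula.realize_inf, hφ R hR v, hψ R hR v]

/-- The quantifier ranges over the ring and is relativised to `ℕ` by `ν`; in `Option α`, the index
`none` is the bound variable. -/
theorem exists_nat {D : (α → ℕ) → ℕ → Prop}
    (hD : UniformlyDefinable.{u} ν (fun v : Option α → ℕ => D (fun i => v (some i)) (v none))) :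
    UniformlyDefinable.{u} ν (fun v => ∃ n, D v n) := by
  obtain ⟨φ, hφ⟩ := hD
  refine ⟨Language.Formula.iExs (Fin 1)
    ((φ.relabel fun o : Option α => o.elim (Sum.inr 0) Sum.inl) ⊓ ν.relabel Sum.inr),
    fun R _ _ hR => ?_⟩
  let _ := Ring.compatibleRingOfRing R
  intro v
  have hφ' : ∀ n : ℕ, φ.Realize ((Sum.elim (fun i => (v i : R)) fun _ : Fin 1 => (n : R)) ∘
      fun o : Option α => o.elim (Sum.inr 0) Sum.inl) ↔ D v n := by
    intro n
    refine Iff.trans ?_ (hφ R hR fun o => o.elim n v)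
    apply iff_of_eq
    congr 1
    funext o
    cases o <;> rfl
  rw [Language.Formula.realize_iExs]
  simp only [Language.Formula.realize_inf, Language.Formula.realize_relabel]
  constructor
  · rintro ⟨x, h₁, h₂⟩
    have hx : x 0 ∈ ringDefinedSet R ν := by
      change ν.Realize fun _ => x 0
      convert h₂ using 1
      funext i
      rw [Subsingleton.elim i 0]
      rfl
    rw [hR] at hx
    obtain ⟨n, hn⟩ := hx
    refine ⟨n, (hφ' n).1 ?_⟩
    convert h₁ using 4
    rename_i i
    rw [Subsingleton.elim i 0, hn]
  · rintro ⟨n, hn⟩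
    refine ⟨fun _ => n, (hφ' n).2 hn, ?_⟩
    have : (n : R) ∈ ringDefinedSet R ν := hR ▸ ⟨n, rfl⟩
    exact this

theorem forall_nat {D : (α → ℕ) → ℕ → Prop}
    (hD : UniformlyDefinable.{u} ν (fun v : Option α → ℕ => D (fun i => v (some i)) (v none))) :
    UniformlyDefinable.{u} ν (fun v => ∀ n, D v n) :=
  (exists_nat (D := fun v n => ¬ D v n) hD.not).not.congr fun v => by simp

theorem imp (hD : UniformlyDefinable.{u} ν D) (hE : UniformlyDefinable.{u} ν E) :
    UniformlyDefinable.{u} ν (fun v => D v → E v) :=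
  (hD.and hE.not).not.congr fun v => by simp

theorem or (hD : UniformlyDefinable.{u} ν D) (hE : UniformlyDefinable.{u} ν E) :
    UniformlyDefinable.{u} ν (fun v => D v ∨ E v) :=
  (hD.not.and hE.not).not.congr fun v => by tauto

theorem lt (hp : IsTermFun.{u} p) (hq : IsTermFun.{u} q) :
    UniformlyDefinable.{u} ν (fun v => p v < q v) :=
  (exists_nat (D := fun v n => p v + 1 + n = q v)
    (eq ((hp.weaken.add .one).add (.var none)) hq.weaken)).congr fun v =>
      ⟨fun h => ⟨q v - (p v + 1), by omega⟩, fun ⟨n, hn⟩ => by omega⟩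

theorem pair_eq (hp : IsTermFun.{u} p) (hq : IsTermFun.{u} q) (hr : IsTermFun.{u} r) :
    UniformlyDefinable.{u} ν (fun v => Nat.pair (p v) (q v) = r v) :=
  (((lt hp hq).and (eq ((hq.mul hq).add hp) hr)).or
    ((lt hp hq).not.and (eq (((hp.mul hp).add hp).add hq) hr))).congr fun v => by
      unfold Nat.pair
      split_ifs with h <;> simp [h]

theorem mod_eq (hp : IsTermFun.{u} p) (hq : IsTermFun.{u} q) (hr : IsTermFun.{u} r)
    (h : ∀ v, 0 < q v) : UniformlyDefinable.{u} ν (fun v => p v % q v = r v) :=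
  ((lt hr hq).and (exists_nat (D := fun v n => r v + q v * n = p v)
    (eq (hr.weaken.add (hq.weaken.mul (.var none))) hp.weaken))).congr fun v => by
      constructor
      · intro hv
        rw [← hv]
        exact ⟨Nat.mod_lt _ (h v), _, Nat.mod_add_div _ _⟩
      · rintro ⟨h₁, n, h₂⟩
        rw [← h₂, Nat.add_mul_mod_self_left, Nat.mod_eq_of_lt h₁]

/-- Gödel's `β` function is uniformly definable. -/
theorem beta_eq (hp : IsTermFun.{u} p) (hq : IsTermFun.{u} q) (hr : IsTermFun.{u} r)
    (hs : IsTermFun.{u} s) :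
    UniformlyDefinable.{u} ν (fun v => p v % ((q v + 1) * r v + 1) = s v) :=
  mod_eq hp (((hq.add .one).mul hr).add .one) hs fun _ => Nat.succ_pos _

end UniformlyDefinable

/-- Quantifying over the pair `c, d` replaces quantifying over finite sequences, which first-order
formulas cannot do directly. -/
theorem exists_beta_eq (f : ℕ → ℕ) (n : ℕ) :
    ∃ c d : ℕ, ∀ i ≤ n, c % ((i + 1) * d + 1) = f i := by
  let l := (List.range (n + 1)).map f
  refine ⟨(Nat.unbeta l).unpair.1, (Nat.unbeta l).unpair.2, fun i hi => ?_⟩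
  have := Nat.beta_unbeta_coe l ⟨i, by simp [l]; omega⟩
  rw [Nat.beta] at this
  simpa [l] using this

/-- Primitive recursion along a partial step function, through the sequence of its values. -/
theorem mem_natRec_bind_iff (f : Part ℕ) (g : ℕ → ℕ → Part ℕ) (n y : ℕ) :
    y ∈ (Nat.rec f (fun k IH => IH.bind (g k)) n : Part ℕ) ↔
      ∃ c : ℕ → ℕ, c 0 ∈ f ∧ (∀ i < n, c (i + 1) ∈ g i (c i)) ∧ c n = y := by
  induction n generalizing y with
  | zero =>
    constructor
    · intro h
      exact ⟨fun _ => y, h, by simp, rfl⟩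
    · rintro ⟨c, h, -, rfl⟩
      exact h
  | succ n ih =>
    simp only [Part.mem_bind_iff, ih]
    constructor
    · rintro ⟨z, ⟨c, h₀, h₁, rfl⟩, hy⟩
      refine ⟨Function.update c (n + 1) y, by simpa using h₀, fun i hi => ?_, by simp⟩
      rcases Nat.lt_succ_iff_lt_or_eq.1 hi with h | rfl
      · rw [Function.update_of_ne (by omega), Function.update_of_ne (by omega)]
        exact h₁ i h
      · simpa using hy
    · rintro ⟨c, h₀, h₁, rfl⟩
      exact ⟨c n, ⟨c, h₀, fun i hi => h₁ i (by omega), rfl⟩, h₁ n (by omega)⟩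

open UniformlyDefinable in
/-- Graphs of partial recursive functions are uniformly definable. -/
theorem uniformlyDefinable_graph_of_partrec {ν : Language.ring.Formula (Fin 1)} {f : ℕ →. ℕ}
    (hf : Nat.Partrec f) : ∀ {α : Type} {p q : (α → ℕ) → ℕ}, IsTermFun.{u} p → IsTermFun.{u} q →
      UniformlyDefinable.{u} ν (fun v => q v ∈ f (p v)) := by
  induction hf with
  | zero =>
    intro α p q hp hq
    exact (eq hq .zero).congr fun v => by
      change q v ∈ Part.some 0 ↔ _
      simp
  | succ =>
    intro α p q hp hq
    exact (eq hq (hp.add .one)).congr fun v => by simp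
  | left =>
    intro α p q hp hq
    exact (exists_nat (D := fun v n => Nat.pair (q v) n = p v)
      (pair_eq hq.weaken (.var none) hp.weaken)).congr fun v => by
        simp only [PFun.coe_val, Part.mem_some_iff]
        constructor
        · intro h
          exact ⟨(p v).unpair.2, by rw [h, Nat.pair_unpair]⟩
        · rintro ⟨n, h⟩
          rw [← h, Nat.unpair_pair]
  | right =>
    intro α p q hp hq
    exact (exists_nat (D := fun v n => Nat.pair n (q v) = p v)
      (pair_eq (.var none) hq.weaken hp.weaken)).congr fun v => by
        simp only [PFun.coe_val, Part.mem_some_iff]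
        constructor
        · intro h
          exact ⟨(p v).unpair.1, by rw [h, Nat.pair_unpair]⟩
        · rintro ⟨n, h⟩
          rw [← h, Nat.unpair_pair]
  | @pair f g _ _ ihf ihg =>
    intro α p q hp hq
    exact (exists_nat (D := fun v a => ∃ b, a ∈ f (p v) ∧ b ∈ g (p v) ∧ Nat.pair a b = q v)
      (exists_nat (D := fun (v : Option α → ℕ) b => v none ∈ f (p fun i => v (some i)) ∧
          b ∈ g (p fun i => v (some i)) ∧ Nat.pair (v none) b = q fun i => v (some i))
        ((ihf hp.weaken.weaken (.var _)).and ((ihg hp.weaken.weaken (.var _)).and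
          (pair_eq (.var _) (.var _) hq.weaken.weaken))))).congr fun v => by
        simp [Seq.seq, eq_comm]
  | @comp f g _ _ ihf ihg =>
    intro α p q hp hq
    exact (exists_nat (D := fun v a => a ∈ g (p v) ∧ q v ∈ f a)
      ((ihg hp.weaken (.var _)).and (ihf (.var _) hq.weaken))).congr fun v => Part.mem_bind_iff
  | @prec f g _ _ ihf ihg =>
    intro α p q hp hq
    -- `Nat.pair` is defined by cases and is not given as a term, so intermediate pairs are named by
    -- quantified variables `k`, `l` before the induction hypothesis is applied.
    let S (a i z z' : ℕ) : Prop := ∃ k, Nat.pair i z = k ∧ ∃ l, Nat.pair a k = l ∧ z' ∈ g l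
    have hS : ∀ {β : Type} {a i z z' : (β → ℕ) → ℕ}, IsTermFun.{u} a → IsTermFun.{u} i →
        IsTermFun.{u} z → IsTermFun.{u} z' →
        UniformlyDefinable.{u} ν (fun v => S (a v) (i v) (z v) (z' v)) := by
      intro β a i z z' ha hi hz hz'
      exact exists_nat (D := fun v k => Nat.pair (i v) (z v) = k ∧
          ∃ l, Nat.pair (a v) k = l ∧ z' v ∈ g l)
        ((pair_eq hi.weaken hz.weaken (.var _)).and
          (exists_nat (D := fun (v : Option β → ℕ) l =>
              Nat.pair (a fun i => v (some i)) (v none) = l ∧ z' (fun i => v (some i)) ∈ g l)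
            ((pair_eq ha.weaken.weaken (.var _) (.var _)).and
              (ihg (.var _) hz'.weaken.weaken))))
    have hS' : ∀ a i z z', S a i z z' ↔ z' ∈ g (Nat.pair a (Nat.pair i z)) := by
      intro a i z z'
      simp [S]
    let B (c d i z : ℕ) : Prop := c % ((i + 1) * d + 1) = z
    -- `c, d` code a run of the recursion: correct start, correct steps below `n`, final value `y`.
    let T (a n c d y : ℕ) : Prop := (∃ z, B c d 0 z ∧ z ∈ f a) ∧
      (∀ i, i < n → ∃ z, B c d i z ∧ ∃ z', B c d (i + 1) z' ∧ S a i z z') ∧ B c d n y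
    have hT : ∀ {β : Type} {a n c d y : (β → ℕ) → ℕ}, IsTermFun.{u} a → IsTermFun.{u} n →
        IsTermFun.{u} c → IsTermFun.{u} d → IsTermFun.{u} y →
        UniformlyDefinable.{u} ν (fun v => T (a v) (n v) (c v) (d v) (y v)) := by
      intro β a n c d y ha hn hc hd hy
      refine and ?_ (and ?_ (beta_eq hc hn hd hy))
      · exact exists_nat (D := fun v z => B (c v) (d v) 0 z ∧ z ∈ f (a v))
          ((beta_eq hc.weaken .zero hd.weaken (.var _)).and (ihf ha.weaken (.var _)))
      · refine forall_nat (D := fun v i => i < n v → ∃ z, B (c v) (d v) i z ∧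
          ∃ z', B (c v) (d v) (i + 1) z' ∧ S (a v) i z z') (imp (lt (.var _) hn.weaken) ?_)
        refine exists_nat (D := fun (v : Option β → ℕ) z =>
          B (c fun i => v (some i)) (d fun i => v (some i)) (v none) z ∧
          ∃ z', B (c fun i => v (some i)) (d fun i => v (some i)) (v none + 1) z' ∧
            S (a fun i => v (some i)) (v none) z z')
          ((beta_eq hc.weaken.weaken (.var _) hd.weaken.weaken (.var _)).and ?_)
        exact exists_nat (D := fun (v : Option (Option β) → ℕ) z' =>
          B (c fun i => v (some (some i))) (d fun i => v (some (some i))) (v (some none) + 1) z' ∧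
            S (a fun i => v (some (some i))) (v (some none)) (v none) z')
          ((beta_eq hc.weaken.weaken.weaken ((IsTermFun.var _).add .one)
            hd.weaken.weaken.weaken (.var _)).and
            (hS ha.weaken.weaken.weaken (.var _) (.var _) (.var _)))
    have hT' : ∀ a n y, (∃ c d, T a n c d y) ↔
        y ∈ (Nat.rec (f a) (fun k IH => IH.bind fun i => g (Nat.pair a (Nat.pair k i))) n :
          Part ℕ) := by
      intro a n y
      rw [mem_natRec_bind_iff (f a) fun k i => g (Nat.pair a (Nat.pair k i))]
      constructor
      · rintro ⟨c, d, ⟨z, rfl, h₀⟩, h₁, h₂⟩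
        refine ⟨fun i => c % ((i + 1) * d + 1), h₀, fun i hi => ?_, h₂⟩
        obtain ⟨z, rfl, z', rfl, h⟩ := h₁ i hi
        exact (hS' _ _ _ _).1 h
      · rintro ⟨e, h₀, h₁, h₂⟩
        obtain ⟨c, d, h⟩ := exists_beta_eq e n
        exact ⟨c, d, ⟨_, h 0 (Nat.zero_le n), h₀⟩, fun i hi => ⟨_, h i hi.le, _, h (i + 1) hi,
          (hS' _ _ _ _).2 (h₁ i hi)⟩, (h n le_rfl).trans h₂⟩
    refine congr (D := fun v => ∃ a n, Nat.pair a n = p v ∧ ∃ c d, T a n c d (q v)) ?_ ?_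
    · refine exists_nat (D := fun v a => ∃ n, Nat.pair a n = p v ∧ ∃ c d, T a n c d (q v)) ?_
      refine exists_nat (D := fun (v : Option α → ℕ) n =>
        Nat.pair (v none) n = p (fun i => v (some i)) ∧
          ∃ c d, T (v none) n c d (q fun i => v (some i)))
        ((pair_eq (.var _) (.var _) hp.weaken.weaken).and ?_)
      refine exists_nat (D := fun (v : Option (Option α) → ℕ) c =>
        ∃ d, T (v (some none)) (v none) c d (q fun i => v (some (some i)))) ?_
      exact exists_nat (D := fun (v : Option (Option (Option α)) → ℕ) d =>
        T (v (some (some none))) (v (some none)) (v none) d (q fun i => v (some (some (some i)))))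
        (hT (.var _) (.var _) (.var _) (.var _) hq.weaken.weaken.weaken.weaken)
    · intro v
      simp only [hT']
      constructor
      · intro h
        exact ⟨_, _, Nat.pair_unpair _, h⟩
      · rintro ⟨a, n, h, h'⟩
        rw [← h, Nat.unpaired, Nat.unpair_pair]
        exact h'
  | @rfind f _ ih =>
    intro α p q hp hq
    refine congr (D := fun v => (∃ k, Nat.pair (p v) (q v) = k ∧ 0 ∈ f k) ∧
      ∀ m, m < q v → ∃ k, Nat.pair (p v) m = k ∧ ∃ z, z ∈ f k ∧ ¬ z = 0) (and ?_ ?_) ?_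
    · exact exists_nat (D := fun v k => Nat.pair (p v) (q v) = k ∧ 0 ∈ f k)
        ((pair_eq hp.weaken hq.weaken (.var _)).and (ih (.var _) .zero))
    · refine forall_nat (D := fun v m => m < q v → ∃ k, Nat.pair (p v) m = k ∧
        ∃ z, z ∈ f k ∧ ¬ z = 0) (imp (lt (.var _) hq.weaken) ?_)
      refine exists_nat (D := fun (v : Option α → ℕ) k =>
        Nat.pair (p fun i => v (some i)) (v none) = k ∧ ∃ z, z ∈ f k ∧ ¬ z = 0)
        ((pair_eq hp.weaken.weaken (.var _) (.var _)).and ?_)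
      exact exists_nat (D := fun (v : Option (Option α) → ℕ) z => z ∈ f (v none) ∧ ¬ z = 0)
        ((ih (.var _) (.var _)).and (eq (.var _) .zero).not)
    · intro v
      refine Nat.mem_rfind.trans ?_
      simp

/-! ### From arithmetic to undecidability -/

/-- From a formula for `ℤ` one gets a formula for `ℕ` by Lagrange's four squares theorem. -/
theorem exists_formula_nat_of_int (φ : Language.ring.Formula (Fin 1)) :
    ∃ ν : Language.ring.Formula (Fin 1), ∀ (R : Type u) [CommRing R] [CharZero R],
      ringDefinedSet R φ = Set.range (Int.cast : ℤ → R) →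
        ringDefinedSet R ν = Set.range (Nat.cast : ℕ → R) := by
  let y (i : Fin 4) : Language.ring.Term (Fin 1 ⊕ Fin 4) := Language.Term.var (Sum.inr i)
  refine ⟨Language.Formula.iExs (Fin 4)
    (((φ.relabel fun _ => Sum.inr 0) ⊓ (φ.relabel fun _ => Sum.inr 1)) ⊓
      ((φ.relabel fun _ => Sum.inr 2) ⊓ (φ.relabel fun _ => Sum.inr 3)) ⊓
      Language.Term.equal (Language.Term.var (Sum.inl 0))
        (y 0 * y 0 + y 1 * y 1 + y 2 * y 2 + y 3 * y 3)), fun R _ _ hR => ?_⟩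
  let _ := Ring.compatibleRingOfRing R
  have hφ : ∀ x : R, φ.Realize (fun _ => x) ↔ ∃ m : ℤ, (m : R) = x := fun x => by
    have : x ∈ ringDefinedSet R φ ↔ x ∈ Set.range (Int.cast : ℤ → R) := by rw [hR]
    exact this
  ext x
  change Language.Formula.Realize _ (fun _ => x) ↔ _
  rw [Language.Formula.realize_iExs]
  simp only [Language.Formula.realize_inf, Language.Formula.realize_relabel,
    Language.Formula.realize_equal, Ring.realize_add, Ring.realize_mul, y,
    Language.Term.realize_var, Sum.elim_inl, Sum.elim_inr, Function.comp_def, hφ]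
  constructor
  · rintro ⟨z, ⟨⟨⟨a, ha⟩, ⟨b, hb⟩⟩, ⟨c, hc⟩, ⟨d, hd⟩⟩, hx⟩
    refine ⟨(a * a + b * b + c * c + d * d).toNat, ?_⟩
    rw [hx, ← ha, ← hb, ← hc, ← hd, ← Int.cast_natCast, Int.toNat_of_nonneg
      (by linarith [mul_self_nonneg a, mul_self_nonneg b, mul_self_nonneg c, mul_self_nonneg d])]
    push_cast
    rfl
  · rintro ⟨n, rfl⟩
    obtain ⟨a, b, c, d, h⟩ := Nat.sum_four_squares n
    refine ⟨![a, b, c, d], ⟨⟨⟨a, by simp⟩, ⟨b, by simp⟩⟩, ⟨c, by simp⟩, ⟨d, by simp⟩⟩, ?_⟩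
    rw [← h]
    simp [pow_two]

/-- The numeral `1 + ⋯ + 1` in the language of rings. -/
def ringNumeral (α : Type) : ℕ → Language.ring.Term α
  | 0 => 0
  | n + 1 => ringNumeral α n + 1

theorem realize_ringNumeral {α : Type} {R : Type*} [CommRing R] [Ring.CompatibleRing R]
    (v : α → R) (n : ℕ) : (ringNumeral α n).realize v = (n : R) := by
  induction n with
  | zero => simp [ringNumeral]
  | succ n ih => simp [ringNumeral, ih]

theorem primrec_ringTermCode_ringNumeral (k : ℕ) :
    Primrec fun n => ringTermCode (ringNumeral (Empty ⊕ Fin k) n) := by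
  have h : Primrec fun n : ℕ => (Nat.rec (Nat.pair 4 0)
      (fun _ c => Nat.pair 1 (Nat.pair c (Nat.pair 5 0))) n : ℕ) :=
    Primrec.nat_rec₁ _ (Primrec₂.natPair.comp (.const 1)
      (Primrec₂.natPair.comp .snd (.const (Nat.pair 5 0))))
  refine h.of_eq fun n => ?_
  induction n with
  | zero => rfl
  | succ n ih =>
    change Nat.pair 1 (Nat.pair _ (Nat.pair 5 0)) = _
    rw [ih]
    rfl

/-- The sentence `∀ x, x = n → ψ(x)`. -/
def instanceSentence (ψ : Language.ring.Formula (Fin 1)) (n : ℕ) : Language.ring.Sentence :=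
  Language.BoundedFormula.all (n := 0)
    (((Language.Term.var (Sum.inr 0) : Language.ring.Term (Empty ⊕ Fin 1)).bdEqual
      (ringNumeral _ n)).imp (Language.BoundedFormula.relabel (n := 1) (k := 0) Sum.inr ψ))

/-- Guarding by `x = n` instead of substituting the numeral keeps the code of `ψ` constant; only the
code of the numeral varies with `n`. -/
theorem computable_ringFormulaCode_instanceSentence (ψ : Language.ring.Formula (Fin 1)) :
    Computable fun n => ringFormulaCode (instanceSentence ψ n) := by
  refine Primrec.to_comp ?_
  exact Primrec₂.natPair.comp (.const 3) (Primrec₂.natPair.comp (.const 2)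
    (Primrec₂.natPair.comp (Primrec₂.natPair.comp (.const 1)
      (Primrec₂.natPair.comp (.const (Nat.pair 0 0)) (primrec_ringTermCode_ringNumeral 1)))
      (.const _)))

theorem instanceSentence_mem_ringTheory (ψ : Language.ring.Formula (Fin 1)) (n : ℕ) (R : Type u)
    [CommRing R] : instanceSentence ψ n ∈ ringTheory R ↔ (n : R) ∈ ringDefinedSet R ψ := by
  let _ := Ring.compatibleRingOfRing R
  change Language.BoundedFormula.Realize _ _ _ ↔ ψ.Realize fun _ => (n : R)
  rw [instanceSentence, Language.BoundedFormula.realize_all]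
  simp only [Language.BoundedFormula.realize_imp, Language.BoundedFormula.realize_bdEqual,
    realize_ringNumeral, Language.Formula.realize_relabel_sumInr, Language.Term.realize_var,
    Sum.elim_inr]
  have h : ∀ x : R, (Fin.snoc default x : Fin 1 → R) = fun _ => x := fun x => by
    funext i
    fin_cases i
    rfl
  simp [h]

/-- The halting problem. -/
def Halts (n : ℕ) : Prop := ((Denumerable.ofNat Nat.Partrec.Code n).eval 0).Dom

theorem not_computablePred_halts : ¬ ComputablePred Halts := fun h =>
  ComputablePred.halting_problem 0 <| by
    obtain ⟨f, hf, hf'⟩ := ComputablePred.computable_iff.1 h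
    refine ComputablePred.computable_iff.2
      ⟨fun c => f (Encodable.encode c), hf.comp Computable.encode, ?_⟩
    funext c
    have := congrFun hf' (Encodable.encode c)
    rwa [Halts, Denumerable.ofNat_encode] at this

open UniformlyDefinable in
theorem uniformlyDefinable_halts (ν : Language.ring.Formula (Fin 1)) :
    UniformlyDefinable.{u} ν (fun v : Fin 1 → ℕ => Halts (v 0)) := by
  have h : Nat.Partrec fun n => (Denumerable.ofNat Nat.Partrec.Code n).eval 0 :=
    Partrec.nat_iff.1 (Nat.Partrec.Code.eval_part.comp (Computable.ofNat _) (Computable.const 0))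
  exact (exists_nat (D := fun (v : Fin 1 → ℕ) y =>
    y ∈ (Denumerable.ofNat Nat.Partrec.Code (v 0)).eval 0)
    (uniformlyDefinable_graph_of_partrec h (.var (some 0)) (.var none))).congr
      fun v => Part.dom_iff_mem

/-- One computable list of sentences encodes the halting problem in all rings of characteristic
zero in which a given formula defines `ℤ`. -/
theorem exists_sentences_encoding_halts (φ : Language.ring.Formula (Fin 1)) :
    ∃ θ : ℕ → Language.ring.Sentence, Computable (fun n => ringFormulaCode (θ n)) ∧
      ∀ (R : Type u) [CommRing R] [CharZero R],
        ringDefinedSet R φ = Set.range (Int.cast : ℤ → R) →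
          ∀ n, θ n ∈ ringTheory R ↔ Halts n := by
  obtain ⟨ν, hν⟩ := exists_formula_nat_of_int.{u} φ
  obtain ⟨ψ, hψ⟩ := uniformlyDefinable_halts.{u} ν
  refine ⟨instanceSentence ψ, computable_ringFormulaCode_instanceSentence ψ,
    fun R _ _ hR n => ?_⟩
  rw [instanceSentence_mem_ringTheory]
  exact hψ R (hν R hR) fun _ => n

theorem not_isDecidableTheory_of_encoding {T : Set Language.ring.Sentence}
    {θ : ℕ → Language.ring.Sentence} {H : ℕ → Prop}
    (hθ : Computable fun n => ringFormulaCode (θ n)) (hH : ¬ ComputablePred H)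
    (h : ∀ n, θ n ∈ T ↔ H n) : ¬ IsDecidableTheory T := by
  rintro ⟨p, hp, hpT⟩
  obtain ⟨f, hf, rfl⟩ := ComputablePred.computable_iff.1 hp
  refine hH (ComputablePred.computable_iff.2 ⟨fun n => f (ringFormulaCode (θ n)), hf.comp hθ, ?_⟩)
  funext n
  exact propext ((h n).symm.trans (hpT (θ n)).symm)

/-! ### The defining formula -/

/-- The equation `X² - a X Y + Y² = 1` with `X = w - 1 + (a - 2) x` and `Y = w + (a - 2) y`. It says
that `Y t - X` is a unit of norm one congruent to `1 + w (t - 1)` modulo `(t - 1)²`, where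
`t + t⁻¹ = a`. -/
def PellCongruence {R : Type*} [CommRing R] (w a x y : R) : Prop :=
  (w - 1 + (a - 2) * x) ^ 2 - a * (w - 1 + (a - 2) * x) * (w + (a - 2) * y)
    + (w + (a - 2) * y) ^ 2 = 1

/-- The solution represents `t ^ m`. Multiplication of `Y t - X` by `t` sends `(X, Y)` to `(Y, a Y -
X)`, and by `t⁻¹` to `(a X - Y, X)`; the witnesses are these maps written in terms of `x, y`. -/
theorem exists_pellCongruence_intCast {R : Type*} [CommRing R] (m : ℤ) (a : R) :
    ∃ x y : R, PellCongruence (m : R) a x y := by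
  unfold PellCongruence
  induction m using Int.induction_on with
  | zero => exact ⟨0, 0, by simp⟩
  | succ i ih =>
    obtain ⟨x, y, h⟩ := ih
    refine ⟨y, 2 * y - x + (i + (a - 2) * y), ?_⟩
    push_cast at h ⊢
    linear_combination h
  | pred i ih =>
    obtain ⟨x, y, h⟩ := ih
    refine ⟨2 * x - y + (-i - 1 + (a - 2) * x), x, ?_⟩
    push_cast at h ⊢
    linear_combination h

/-- The formula `∀ a b, ∃ x y, PellCongruence w a x y` (with a dummy variable `b`). -/
theorem exists_formula_pellCongruence :
    ∃ φ : Language.ring.Formula (Fin 1), IsForallForallExists φ ∧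
      ∀ (R : Type u) [CommRing R],
        ringDefinedSet R φ = {w : R | ∀ a, ∃ x y, PellCongruence w a x y} := by
  let w : Language.ring.Term (Fin 1 ⊕ Fin (2 + 2)) := Language.Term.var (Sum.inl 0)
  let v (i : Fin 4) : Language.ring.Term (Fin 1 ⊕ Fin (2 + 2)) := Language.Term.var (Sum.inr i)
  let c := v 0 + -(1 + 1)
  let X := w + -1 + c * v 2
  let Y := w + c * v 3
  let t := X * X + -(v 0 * X * Y) + Y * Y
  refine ⟨_, ⟨2, by norm_num, t, 1, rfl⟩, fun R _ => ?_⟩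
  let _ := Ring.compatibleRingOfRing R
  ext z
  change Language.BoundedFormula.Realize _ _ _ ↔ _
  simp only [exBlock, Language.BoundedFormula.realize_all, Language.BoundedFormula.realize_ex,
    Language.BoundedFormula.realize_bdEqual, t, X, Y, c, v, w, Ring.realize_add, Ring.realize_mul,
    Ring.realize_neg, Ring.realize_one, Language.Term.realize_var, Sum.elim_inl, Sum.elim_inr]
  have h₀ (a b x y : R) : (Fin.snoc (Fin.snoc (Fin.snoc (Fin.snoc default a : Fin 1 → R) b :
      Fin 2 → R) x : Fin 3 → R) y : Fin 4 → R) = ![a, b, x, y] := by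
    funext i
    fin_cases i <;> rfl
  constructor
  · intro h a
    obtain ⟨x, y, h⟩ := h a 0
    rw [h₀] at h
    refine ⟨x, y, ?_⟩
    simp at h
    unfold PellCongruence
    linear_combination h
  · intro h a b
    obtain ⟨x, y, h⟩ := h a
    refine ⟨x, y, ?_⟩
    rw [h₀]
    simp
    unfold PellCongruence at h
    linear_combination h

/-! ### Non-big fields -/

/-- If all prime powers divided degrees of subfields, composita would handle products of coprime
factors, hence every `n`. -/
theorem exists_prime_pow_not_dvd_finrank {K : Type u} [Field K] [CharZero K]
    (hK : ¬ IsBigField K) : ∃ p e : ℕ, p.Prime ∧ ∀ F : IntermediateField ℚ K,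
      FiniteDimensional ℚ F → ¬ p ^ e ∣ Module.finrank ℚ F := by
  by_contra! h
  refine hK fun n => ?_
  induction n using Nat.recOnPosPrimePosCoprime with
  | zero => exact fun h => absurd h (lt_irrefl 0)
  | one => exact fun _ => ⟨⊥, inferInstance, one_dvd _⟩
  | prime_pow p n hp hn => exact fun _ => h p n hp
  | coprime a b ha hb hab iha ihb =>
    intro _
    obtain ⟨F, _, hF'⟩ := iha (by omega)
    obtain ⟨E, _, hE'⟩ := ihb (by omega)
    exact ⟨F ⊔ E, inferInstance, hab.mul_dvd_of_dvd_of_dvd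
      (hF'.trans (IntermediateField.finrank_dvd_of_le_right le_sup_left))
      (hE'.trans (IntermediateField.finrank_dvd_of_le_right le_sup_right))⟩

theorem not_isBigField_of_numberField (K : Type u) [Field K] [NumberField K] :
    ¬ IsBigField K := by
  intro h
  obtain ⟨F, hF, hn⟩ := h (Module.finrank ℚ K + 1) (Nat.succ_pos _)
  have h₁ := Nat.le_of_dvd Module.finrank_pos hn
  have h₂ : Module.finrank ℚ F ≤ Module.finrank ℚ K :=
    Submodule.finrank_le (Subalgebra.toSubmodule F.toSubalgebra)
  omega

/-! ### Divisibility in lattices -/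

/-- The submodules killed by `k!` form an ascending chain whose union is the torsion; where it
stabilises, `k!` kills all torsion. -/
theorem exists_smul_eq_zero_of_isNoetherian (M : Type*) [AddCommGroup M] [IsNoetherian ℤ M] :
    ∃ D : ℤ, D ≠ 0 ∧ ∀ (a : M) (N : ℤ), N ≠ 0 → N • a = 0 → D • a = 0 := by
  let T : ℕ →o Submodule ℤ M :=
    { toFun := fun k => Submodule.torsionBy ℤ M (k.factorial : ℤ)
      monotone' := fun k l hkl =>
        Submodule.torsionBy_le_torsionBy_of_dvd _ _
          (Int.natCast_dvd_natCast.2 (Nat.factorial_dvd_factorial hkl)) }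
  obtain ⟨k, hk⟩ := monotone_stabilizes_iff_noetherian.2 ‹IsNoetherian ℤ M› T
  refine ⟨k.factorial, by exact_mod_cast k.factorial_ne_zero, fun a N hN ha => ?_⟩
  have h : a ∈ T (k + N.natAbs) := by
    refine Submodule.torsionBy_le_torsionBy_of_dvd N _ ?_ ha
    exact Int.natAbs_dvd.1 (Int.natCast_dvd_natCast.2
      (Nat.dvd_factorial (Int.natAbs_pos.2 hN) (Nat.le_add_left _ _)))
  rw [← hk _ (Nat.le_add_right _ _)] at h
  exact h

/-- In a lattice, the coefficients of a combination of independent vectors that is divisible by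
`N` are divisible by `N` up to a bounded factor. -/
theorem LinearIndependent.exists_dvd_mul_coeff {A ι : Type*} [AddCommGroup A] [IsNoetherian ℤ A]
    [Fintype ι] {v : ι → A} (hv : LinearIndependent ℤ v) :
    ∃ D : ℤ, D ≠ 0 ∧ ∀ (y : ι → ℤ) (N : ℤ) (a : A), N ≠ 0 → ∑ i, y i • v i = N • a →
      ∀ i, N ∣ D * y i := by
  let S := Submodule.span ℤ (Set.range v)
  -- The class of `a` is torsion in `A ⧸ S`, so a uniform `D` moves `a` into the span, where
  -- coefficients can be compared.
  obtain ⟨D, hD, h⟩ := exists_smul_eq_zero_of_isNoetherian (A ⧸ S)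
  refine ⟨D, hD, fun y N a hN hy i => ?_⟩
  have h₁ : N • a ∈ S := by
    rw [← hy]
    exact Submodule.sum_mem _ fun i _ => Submodule.smul_mem _ _ (Submodule.subset_span ⟨i, rfl⟩)
  have h₂ : D • a ∈ S := by
    rw [← Submodule.Quotient.mk_eq_zero, Submodule.Quotient.mk_smul] at h₁ ⊢
    exact h _ N hN h₁
  obtain ⟨z, hz⟩ := (Submodule.mem_span_range_iff_exists_fun ℤ).1 h₂
  have h₃ : ∑ j, (N * z j) • v j = ∑ j, (D * y j) • v j := by
    simp only [mul_smul, ← Finset.smul_sum, hz, hy]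
    exact smul_comm _ _ _
  have h₄ := Fintype.linearIndependent_iff.1 hv (fun j => N * z j - D * y j) (by
    simp only [sub_smul, Finset.sum_sub_distrib, h₃, sub_self]) i
  exact ⟨z i, by linarith⟩

/-! ### Units congruent to one -/

theorem exists_one_add_pow_eq {R : Type*} [CommRing R] (x : R) (n : ℕ) :
    ∃ k, (1 + x) ^ n = 1 + n * x + x ^ 2 * k := by
  induction n with
  | zero => exact ⟨0, by simp⟩
  | succ n ih =>
    obtain ⟨k, hk⟩ := ih
    refine ⟨k + n + x * k, ?_⟩
    rw [pow_succ, hk]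
    push_cast
    ring

/-- Raise to the `p`-th power repeatedly. The factor `p ^ 2` makes the quadratic error negligible
without using divisibility of binomial coefficients, so `p = 2` needs no special care. -/
theorem exists_one_add_pow_prime_pow_eq {R : Type*} [CommRing R] (p : ℕ) (s : R) (j : ℕ) :
    ∃ y, (1 + (p : R) ^ 2 * s) ^ p ^ j = 1 + (p : R) ^ j * (p ^ 2 * s) * (1 + p * y) := by
  induction j with
  | zero => exact ⟨0, by simp⟩
  | succ j ih =>
    obtain ⟨y, hy⟩ := ih
    obtain ⟨k, hk⟩ := exists_one_add_pow_eq ((p : R) ^ j * (p ^ 2 * s) * (1 + p * y)) p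
    refine ⟨y + p ^ j * s * (1 + p * y) ^ 2 * k, ?_⟩
    rw [pow_succ p j, pow_mul, hy, hk]
    ring

/-- Units `ε ≡ 1 + P β` modulo `P²`. -/
def CongruentOneAdd {R : Type*} [CommRing R] (P : R) (ε : Rˣ) (β : R) : Prop :=
  ∃ c, (ε : R) = 1 + P * β + P ^ 2 * c

namespace CongruentOneAdd

variable {R : Type*} [CommRing R] {P : R} {ε ε' : Rˣ} {β β' : R}

theorem one : CongruentOneAdd P 1 0 := ⟨0, by simp⟩

/-- The coefficient `β` behaves as a logarithm modulo `P`: products of units become sums. -/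
theorem mul (h : CongruentOneAdd P ε β) (h' : CongruentOneAdd P ε' β') :
    CongruentOneAdd P (ε * ε') (β + β') := by
  obtain ⟨c, hc⟩ := h
  obtain ⟨c', hc'⟩ := h'
  refine ⟨β * β' + c' + c + P * β * c' + P * c * β' + P ^ 2 * c * c', ?_⟩
  rw [Units.val_mul, hc, hc']
  ring

theorem inv (h : CongruentOneAdd P ε β) : CongruentOneAdd P ε⁻¹ (-β) := by
  obtain ⟨c, hc⟩ := h
  refine ⟨(β ^ 2 - c + P * β * c) * (ε⁻¹ : Rˣ), ?_⟩
  have h₁ : (1 - P * β) * (ε : R) = 1 + P ^ 2 * (-β ^ 2 + c - P * β * c) := by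
    rw [hc]
    ring
  have h₂ : (ε : R) * (ε⁻¹ : Rˣ) = 1 := ε.mul_inv
  linear_combination (-((ε⁻¹ : Rˣ) : R)) * h₁ + (1 - P * β) * h₂

theorem pow (h : CongruentOneAdd P ε β) (n : ℕ) : CongruentOneAdd P (ε ^ n) (n * β) := by
  induction n with
  | zero => simpa using one
  | succ n ih =>
    rw [pow_succ]
    convert ih.mul h using 1
    push_cast
    ring

theorem zpow (h : CongruentOneAdd P ε β) (n : ℤ) : CongruentOneAdd P (ε ^ n) (n * β) := by
  cases n with
  | ofNat n => simpa using h.pow n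
  | negSucc n =>
    rw [zpow_negSucc]
    convert (h.pow (n + 1)).inv using 1
    push_cast
    ring

theorem prod {ι : Type*} (s : Finset ι) {ε : ι → Rˣ} {β : ι → R}
    (h : ∀ i ∈ s, CongruentOneAdd P (ε i) (β i)) :
    CongruentOneAdd P (∏ i ∈ s, ε i) (∑ i ∈ s, β i) := by
  classical
  induction s using Finset.induction_on with
  | empty => simpa using one
  | insert i s hi ih =>
    rw [Finset.prod_insert hi, Finset.sum_insert hi]
    exact (h i (by simp)).mul (ih fun j hj => h j (by simp [hj]))

theorem dvd_of_one [IsDomain R] (hP : P ≠ 0) (h : CongruentOneAdd P 1 β) : P ∣ β := by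
  obtain ⟨c, hc⟩ := h
  refine ⟨-c, mul_left_cancel₀ hP ?_⟩
  rw [Units.val_one] at hc
  linear_combination -hc

end CongruentOneAdd

theorem exists_pow_sub_one_dvd {R : Type*} [CommRing R] (ε : Rˣ) (P : R)
    [Finite (R ⧸ Ideal.span {P})] : ∃ N : ℕ, 0 < N ∧ P ∣ ((ε ^ N : Rˣ) : R) - 1 := by
  let f : Rˣ →* (R ⧸ Ideal.span {P})ˣ := Units.map (Ideal.Quotient.mk (Ideal.span {P}))
  obtain ⟨N, hN, h⟩ := isOfFinOrder_iff_pow_eq_one.1 (isOfFinOrder_of_finite (f ε))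
  refine ⟨N, hN, ?_⟩
  rw [← Ideal.mem_span_singleton, ← Ideal.Quotient.eq_zero_iff_mem, map_sub, sub_eq_zero, map_one]
  rw [← map_pow] at h
  exact congrArg Units.val h

theorem Prime.not_pow_add_dvd_mul {M : Type*} [CommMonoidWithZero M] [IsCancelMulZero M] {p : M}
    (hp : Prime p) {a b : ℕ} {x y : M} (hx : ¬ p ^ a ∣ x) (hy : ¬ p ^ b ∣ y) :
    ¬ p ^ (a + b) ∣ x * y := by
  induction b with
  | zero => simp at hy
  | succ b ih =>
    intro h
    by_cases hb : p ^ b ∣ y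
    · obtain ⟨z, rfl⟩ := hb
      rw [← add_assoc, add_right_comm, pow_add, mul_left_comm, mul_comm (p ^ (a + 1))] at h
      have hz : ¬ p ∣ z := fun hz => hy (pow_succ p b ▸ mul_dvd_mul_left _ hz)
      have := hp.pow_dvd_of_dvd_mul_right _ hz
        ((mul_dvd_mul_iff_left (pow_ne_zero b hp.ne_zero)).1 h)
      exact hx ((pow_dvd_pow p (Nat.le_succ a)).trans this)
    · exact ih hb ((pow_dvd_pow p (Nat.le_succ _)).trans h)

/-! ### Multiplicative relations among units and the rank contradiction -/

open NumberField

/-- Enough units are multiplicatively dependent, with coprime exponents up to torsion. -/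
theorem exists_prod_zpow_eq_one {L : Type*} [Field L] [NumberField L] {n : ℕ}
    (hn : Units.rank L < n) (η : Fin n → (𝓞 L)ˣ) :
    ∃ x : Fin n → ℤ, Finset.univ.gcd x = 1 ∧
      ∏ i, η i ^ (x i * (Units.torsionOrder L : ℤ)) = 1 := by
  have h : ¬ LinearIndependent ℤ fun i => Additive.ofMul (η i) := fun h => by
    have := h.fintype_card_le_finrank
    rw [Units.finrank_eq, Fintype.card_fin] at this
    omega
  rw [Fintype.not_linearIndependent_iff] at h
  obtain ⟨y, hy, i, hi⟩ := h
  obtain ⟨x, hx, hg⟩ := Finset.extract_gcd y (s := Finset.univ) ⟨i, Finset.mem_univ i⟩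
  refine ⟨x, hg, ?_⟩
  set g := Finset.univ.gcd y
  have hg0 : g ≠ 0 := fun h => hi (by rw [hx i (Finset.mem_univ i), h, zero_mul])
  have h₁ : ∏ i, η i ^ (g * x i) = 1 := by
    have := congrArg Additive.toMul hy
    simp only [toMul_sum, toMul_zsmul, toMul_ofMul, toMul_zero] at this
    rw [← this]
    exact Finset.prod_congr rfl fun i hi => by rw [hx i hi]
  have h₂ : (∏ i, η i ^ x i) ^ g = 1 := by
    rw [← h₁, ← Finset.prod_zpow]
    exact Finset.prod_congr rfl fun i _ => by rw [← zpow_mul, mul_comm]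
  -- Dividing the exponents by their gcd `g` leaves a unit whose `g`-th power is `1`, which the
  -- torsion order then kills.
  have h₃ : ∏ i, η i ^ x i ∈ Units.torsion L := by
    refine isOfFinOrder_iff_zpow_eq_one.2 ⟨g, hg0, h₂⟩
  have h₄ : (∏ i, η i ^ x i) ^ Units.torsionOrder L = 1 := by
    have := pow_card_eq_one' (x := (⟨_, h₃⟩ : Units.torsion L))
    exact congrArg Subtype.val this
  rw [← h₄, ← zpow_natCast, ← Finset.prod_zpow]
  exact Finset.prod_congr rfl fun i _ => by rw [← zpow_mul]

/-- If `w` has degree larger than the rank of the unit group, then there cannot be a set `E` of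
units, stable under powers and containing a unit of infinite order, such that for every `t ∈ E`
there is a unit `1 + m w (t - 1)` modulo `(t - 1)²` in `E`, with `m` of bounded `p`-adic
valuation. -/
theorem false_of_units_one_add_mul {L : Type*} [Field L] [NumberField L] {n p e : ℕ}
    (hn : Units.rank L < n) (hp : p.Prime) {w : 𝓞 L}
    (hw : LinearIndependent ℤ fun i : Fin n => w ^ (i : ℕ)) (E : Set (𝓞 L)ˣ) {t₀ : (𝓞 L)ˣ}
    (ht₀ : ∀ k, t₀ ^ k ∈ E) (ht₀' : ∀ k, 0 < k → t₀ ^ k ≠ 1)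
    (hE : ∀ t ∈ E, ∃ η ∈ E, ∃ m : ℕ, ¬ p ^ e ∣ m ∧
      ((t : 𝓞 L) - 1) ^ 2 ∣ (η : 𝓞 L) - (1 + m * w * (t - 1))) : False := by
  have hp0 : (p : 𝓞 L) ≠ 0 := by exact_mod_cast hp.ne_zero
  obtain ⟨D, hD, hDw⟩ := hw.exists_dvd_mul_coeff
  have : Finite (𝓞 L ⧸ Ideal.span {(p : 𝓞 L) ^ 2}) :=
    Ideal.finiteQuotientOfFreeOfNeBot _ (by simpa using hp0)
  obtain ⟨N, hN, s, hs⟩ := exists_pow_sub_one_dvd t₀ ((p : 𝓞 L) ^ 2)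
  rw [sub_eq_iff_eq_add'] at hs
  have hs0 : (p : 𝓞 L) ^ 2 * s ≠ 0 := fun h => ht₀' N hN (by
    rw [h, add_zero] at hs
    exact Units.ext hs)
  -- An ideal contains its absolute norm, so `p² s` divides a nonzero integer; this later trades the
  -- factor `p² s` of `b` for the integer `B`.
  obtain ⟨B, hB, s', hs'⟩ : ∃ B : ℤ, B ≠ 0 ∧ (p : 𝓞 L) ^ 2 * s ∣ (B : 𝓞 L) := by
    refine ⟨Ideal.absNorm (Ideal.span {(p : 𝓞 L) ^ 2 * s}), ?_, ?_⟩
    · simpa [Ideal.absNorm_eq_zero_iff] using hs0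
    · rw [← Ideal.mem_span_singleton]
      exact_mod_cast Ideal.absNorm_mem _
  set q := Units.torsionOrder L
  set A : ℤ := D * (q * B)
  have hA : A ≠ 0 := by
    have : (q : ℤ) ≠ 0 := by exact_mod_cast Units.torsionOrder_ne_zero L
    positivity
  obtain ⟨a, ha⟩ : ∃ a : ℕ, ¬ (p : ℤ) ^ a ∣ A := by
    obtain ⟨a, ha⟩ := Int.finiteMultiplicity_iff (a := (p : ℤ)).2 ⟨by simpa using hp.one_lt.ne', hA⟩
    exact ⟨a + 1, ha⟩
  -- Here `a` exceeds the valuation of `D q B`, and `e * n + 1` that of every `M i`; neither depends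
  -- on `j`.
  let j := a + (e * n + 1)
  obtain ⟨y, hy⟩ := exists_one_add_pow_prime_pow_eq p s j
  rw [← hs] at hy
  set P : 𝓞 L := (p : 𝓞 L) ^ j
  set b : 𝓞 L := p ^ 2 * s * (1 + p * y)
  have hP0 : P ≠ 0 := pow_ne_zero _ hp0
  -- iterating the hypothesis
  have key : ∀ i : ℕ, ∃ η ∈ E, ∃ M : ℕ, ¬ p ^ (e * i + 1) ∣ M ∧
      CongruentOneAdd P η (M * w ^ i * b) := by
    intro i
    induction i with
    | zero =>
      refine ⟨t₀ ^ (N * p ^ j), ht₀ _, 1, ?_, 0, ?_⟩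
      · simpa using hp.one_lt.ne'
      · rw [pow_mul, Units.val_pow_eq_pow_val, hy]
        simp only [b]
        push_cast
        ring
    | succ i ih =>
      obtain ⟨t, ht, M, hM, c, hc⟩ := ih
      -- Since `t - 1` is divisible by `P`, the error `(t - 1)²` is absorbed by `P²`, and the
      -- coefficient is multiplied by `m w`.
      obtain ⟨η, hη, m, hm, d, hd⟩ := hE t ht
      refine ⟨η, hη, m * M, ?_, m * w * c + (M * w ^ i * b + P * c) ^ 2 * d, ?_⟩
      · have := hp.prime.not_pow_add_dvd_mul hm hM
        rwa [← add_assoc, ← mul_one_add, add_comm 1 i] at this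
      · rw [sub_eq_iff_eq_add.1 hd, hc]
        push_cast
        ring
  choose η hη M hM hcong using key
  obtain ⟨x, hx, hx'⟩ := exists_prod_zpow_eq_one hn fun i : Fin n => η i
  have h₁ := CongruentOneAdd.prod Finset.univ
    fun (i : Fin n) _ => (hcong i).zpow (x i * (q : ℤ))
  rw [hx'] at h₁
  have h₂ := h₁.dvd_of_one hP0
  have h₃ : P ∣ (∑ i : Fin n, (B * (q * x i * M i) : ℤ) • w ^ (i : ℕ)) := by
    -- The remaining factor of `b` is invertible modulo `p`, hence modulo `P`, and can be cancelled.
    have hcop : IsCoprime P (1 + p * y) := IsCoprime.pow_left ⟨-y, 1, by ring⟩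
    refine hcop.dvd_of_dvd_mul_right ?_
    refine (h₂.mul_left s').trans (dvd_of_eq ?_)
    rw [Finset.mul_sum, Finset.sum_mul]
    refine Finset.sum_congr rfl fun i _ => ?_
    simp only [zsmul_eq_mul, b]
    push_cast
    rw [hs']
    ring
  obtain ⟨z, hz⟩ := h₃
  have h₄ := hDw _ ((p : ℤ) ^ j) z (pow_ne_zero _ (by exact_mod_cast hp.ne_zero))
    (by rw [hz, zsmul_eq_mul]; push_cast; rfl)
  have hpZ : Prime (p : ℤ) := Nat.prime_iff_prime_int.1 hp
  have h₅ : ∀ i, (p : ℤ) ∣ x i := by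
    intro i
    by_contra hi
    have hMi : ¬ (p : ℤ) ^ (e * n + 1) ∣ M i := fun h => hM i
      ((pow_dvd_pow p (show e * i + 1 ≤ e * n + 1 by gcongr; omega)).trans (Int.natCast_dvd_natCast.1 (by push_cast; exact h)))
    refine hpZ.not_pow_add_dvd_mul ha hMi (hpZ.pow_dvd_of_dvd_mul_right _ hi ?_)
    refine (h₄ i).trans (dvd_of_eq ?_)
    simp only [A]
    ring
  have h₆ := Finset.dvd_gcd (s := Finset.univ) (f := x) fun i _ => h₅ i
  rw [hx] at h₆
  exact hpZ.not_isUnit (isUnit_of_dvd_one h₆)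

/-! ### Norms of units -/

section Norm

open NumberField RingOfIntegers

theorem exists_ringOfIntegers_algebraMap_eq {k Ω : Type*} [Field k] [Field Ω] [Algebra k Ω]
    [IsGalois k Ω] {z : 𝓞 Ω} (hz : ∀ g : Gal(Ω/k), mapRingHom (g : Ω →+* Ω) z = z) :
    ∃ n : 𝓞 k, algebraMap (𝓞 k) (𝓞 Ω) n = z := by
  obtain ⟨l, hl⟩ := (InfiniteGalois.mem_range_algebraMap_iff_fixed (k := k) (z : Ω)).2
    fun g => congrArg (fun y : 𝓞 Ω => (y : Ω)) (hz g)
  have hl' : IsIntegral ℤ l := by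
    rw [← isIntegral_algebraMap_iff (algebraMap k Ω).injective, hl]
    exact z.isIntegral_coe
  exact ⟨⟨l, hl'⟩, RingOfIntegers.ext hl⟩

theorem ringOfIntegers_algebraMap_injective (k Ω : Type*) [Field k] [Field Ω] [Algebra k Ω] :
    Function.Injective (algebraMap (𝓞 k) (𝓞 Ω)) := fun _ _ h =>
  RingOfIntegers.ext ((algebraMap k Ω).injective (congrArg (fun z : 𝓞 Ω => (z : Ω)) h))

/-- The quotient lies in `k` and is integral, since its image in `Ω` is. -/
theorem ringOfIntegers_dvd_of_algebraMap_dvd {k Ω : Type*} [Field k] [Field Ω] [Algebra k Ω]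
    {x y : 𝓞 k} (h : algebraMap (𝓞 k) (𝓞 Ω) x ∣ algebraMap (𝓞 k) (𝓞 Ω) y) : x ∣ y := by
  rcases eq_or_ne x 0 with rfl | hx
  · rw [map_zero, zero_dvd_iff, map_eq_zero_iff _ (ringOfIntegers_algebraMap_injective k Ω)] at h
    rw [h]
  obtain ⟨c, hc⟩ := h
  have hx' : (x : k) ≠ 0 := coe_ne_zero_iff.2 hx
  have hc' : algebraMap k Ω (y : k) = algebraMap k Ω (x : k) * (c : Ω) :=
    congrArg (fun z : 𝓞 Ω => (z : Ω)) hc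
  have hq : algebraMap k Ω ((y : k) / x) = (c : Ω) := by
    rw [map_div₀, hc', mul_div_cancel_left₀]
    exact (map_ne_zero _).2 hx'
  have hq' : IsIntegral ℤ ((y : k) / x) := by
    rw [← isIntegral_algebraMap_iff (algebraMap k Ω).injective, hq]
    exact c.isIntegral_coe
  exact ⟨⟨_, hq'⟩, RingOfIntegers.ext (mul_div_cancel₀ (y : k) hx').symm⟩

/-- Let `t` be a unit with `t + t⁻¹ = a`. A solution of the equation `PellCongruence w a x y` in an
extension `E` yields, by taking norms, a unit congruent to `1 + [E : F] w (t - 1)` modulo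
`(t - 1)²`. -/
theorem exists_unit_of_pellCongruence {F E L : Type*} (Ω : Type*) [Field F] [Field E] [Field L]
    [Field Ω] [CharZero F] [Algebra F E] [FiniteDimensional F E] [Algebra F L] [Algebra F Ω]
    [Algebra L Ω] [IsScalarTower F L Ω] [IsAlgClosed Ω] [Algebra.IsAlgebraic F Ω]
    {w a : 𝓞 F} {x y : 𝓞 E}
    (h : PellCongruence (algebraMap (𝓞 F) (𝓞 E) w) (algebraMap (𝓞 F) (𝓞 E) a) x y)
    {t : (𝓞 L)ˣ} (ht : (t : 𝓞 L) + (t⁻¹ : (𝓞 L)ˣ) = algebraMap (𝓞 F) (𝓞 L) a) :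
    ∃ η : (𝓞 L)ˣ, (∃ a' : 𝓞 F, (η : 𝓞 L) + (η⁻¹ : (𝓞 L)ˣ) = algebraMap (𝓞 F) (𝓞 L) a') ∧
      ((t : 𝓞 L) - 1) ^ 2 ∣
        (η : 𝓞 L) - (1 + Module.finrank F E * algebraMap (𝓞 F) (𝓞 L) w * (t - 1)) := by
  have : CharZero L := charZero_of_injective_algebraMap (algebraMap F L).injective
  have : Algebra.IsAlgebraic L Ω := Algebra.IsAlgebraic.tower_top (K := F) L
  have : IsAlgClosure F Ω := ⟨inferInstance, inferInstance⟩
  have : IsAlgClosure L Ω := ⟨inferInstance, inferInstance⟩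
  have : Normal F Ω := IsAlgClosure.normal F Ω
  have : Normal L Ω := IsAlgClosure.normal L Ω
  have : IsGalois F Ω := .mk
  have : IsGalois L Ω := .mk
  let f (σ : E →ₐ[F] Ω) : 𝓞 E →+* 𝓞 Ω := mapRingHom (σ : E →+* Ω)
  let ω := algebraMap (𝓞 F) (𝓞 Ω) w
  let α := algebraMap (𝓞 F) (𝓞 Ω) a
  have hf (σ) (z : 𝓞 F) : f σ (algebraMap (𝓞 F) (𝓞 E) z) = algebraMap (𝓞 F) (𝓞 Ω) z :=
    RingOfIntegers.ext (σ.commutes (z : F))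
  have hFL (z : 𝓞 F) : algebraMap (𝓞 L) (𝓞 Ω) (algebraMap (𝓞 F) (𝓞 L) z) =
      algebraMap (𝓞 F) (𝓞 Ω) z :=
    (IsScalarTower.algebraMap_apply (𝓞 F) (𝓞 L) (𝓞 Ω) z).symm
  let T : (𝓞 Ω)ˣ := Units.map (algebraMap (𝓞 L) (𝓞 Ω) : 𝓞 L →* 𝓞 Ω) t
  let τ : 𝓞 Ω := T
  let τ' : 𝓞 Ω := (T⁻¹ : (𝓞 Ω)ˣ)
  have hττ : τ * τ' = 1 := T.mul_inv
  have hτα : τ + τ' = α := by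
    have := congrArg (algebraMap (𝓞 L) (𝓞 Ω)) ht
    rwa [map_add, hFL] at this
  let X (σ) : 𝓞 Ω := ω - 1 + (α - 2) * f σ x
  let Y (σ) : 𝓞 Ω := ω + (α - 2) * f σ y
  have hXY (σ) : X σ ^ 2 - α * X σ * Y σ + Y σ ^ 2 = 1 := by
    have := congrArg (f σ) h
    simpa only [map_add, map_sub, map_mul, map_pow, map_one, map_ofNat, hf] using this
  have hu (σ) : (Y σ * τ - X σ) * (Y σ * τ' - X σ) = 1 := by
    linear_combination hXY σ + Y σ ^ 2 * hττ - X σ * Y σ * hτα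
  have hu' (σ) : (Y σ * τ' - X σ) * (Y σ * τ - X σ) = 1 := (mul_comm _ _).trans (hu σ)
  let ε (σ) : (𝓞 Ω)ˣ := ⟨Y σ * τ - X σ, Y σ * τ' - X σ, hu σ, hu' σ⟩
  have hε (σ) : CongruentOneAdd (τ - 1) (ε σ) ω := by
    -- This comes from `α - 2 = τ' (τ - 1)²` and `τ τ' = 1`.
    refine ⟨f σ y - f σ x * τ', ?_⟩
    simp only [ε, X, Y, ← hτα]
    linear_combination (f σ x * (τ - 2) + f σ y) * hττ
  let N := ∏ σ, ε σ
  have hN : CongruentOneAdd (τ - 1) N (Module.finrank F E * ω) := by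
    have := CongruentOneAdd.prod (Finset.univ) fun (σ : E →ₐ[F] Ω) _ => hε σ
    rwa [Finset.sum_const, Finset.card_univ, AlgHom.card, nsmul_eq_mul] at this
  have hN₁ : (N : 𝓞 Ω) = ∏ σ, (Y σ * τ - X σ) := by
    simp [N, ε, Units.coe_prod]
  have hN₂ : ((N⁻¹ : (𝓞 Ω)ˣ) : 𝓞 Ω) = ∏ σ, (Y σ * τ' - X σ) := by
    simp [N, ε, Units.coe_prod, ← Finset.prod_inv_distrib]
  -- the action of the Galois group
  have hg (g : Gal(Ω/F)) (ρ ρ' : 𝓞 Ω) (hρ : mapRingHom (g : Ω →+* Ω) ρ = ρ') :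
      mapRingHom (g : Ω →+* Ω) (∏ σ, (Y σ * ρ - X σ)) = ∏ σ, (Y σ * ρ' - X σ) := by
    have h₁ (z : 𝓞 F) : mapRingHom (g : Ω →+* Ω) (algebraMap (𝓞 F) (𝓞 Ω) z) =
        algebraMap (𝓞 F) (𝓞 Ω) z := RingOfIntegers.ext (g.commutes (z : F))
    have h₂ (σ) (z : 𝓞 E) : mapRingHom (g : Ω →+* Ω) (f σ z) = f ((g : Ω →ₐ[F] Ω).comp σ) z := rfl
    rw [map_prod]
    -- An automorphism over `F` permutes the embeddings of `E`, so it affects the product only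
    -- through `ρ`.
    refine Fintype.prod_bijective (fun σ => (g : Ω →ₐ[F] Ω).comp σ)
      (Finite.injective_iff_bijective.1 fun σ σ' hσ => ?_) _ _ fun σ => ?_
    · exact AlgHom.ext fun z => g.injective (DFunLike.congr_fun hσ z)
    · simp only [map_sub, map_mul, map_add, map_one, map_ofNat, hρ, X, Y, h₁, h₂, ω, α]
  -- `τ` and `τ'` are the roots of `Z² - α Z + 1`, so `g` fixes or swaps them. Accordingly it fixes
  -- or swaps `N` and `N⁻¹`, whose sum therefore descends to `F`.
  have hτ (g : Gal(Ω/F)) : (mapRingHom (g : Ω →+* Ω) τ = τ ∧ mapRingHom (g : Ω →+* Ω) τ' = τ') ∨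
      (mapRingHom (g : Ω →+* Ω) τ = τ' ∧ mapRingHom (g : Ω →+* Ω) τ' = τ) := by
    have h₁ : mapRingHom (g : Ω →+* Ω) α = α := RingOfIntegers.ext (g.commutes (a : F))
    have h₂ : mapRingHom (g : Ω →+* Ω) τ + mapRingHom (g : Ω →+* Ω) τ' = α := by
      rw [← map_add, hτα, h₁]
    have h₃ : mapRingHom (g : Ω →+* Ω) τ * mapRingHom (g : Ω →+* Ω) τ' = 1 := by
      rw [← map_mul, hττ, map_one]
    have h₄ : (mapRingHom (g : Ω →+* Ω) τ - τ) * (mapRingHom (g : Ω →+* Ω) τ - τ') = 0 := by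
      linear_combination mapRingHom (g : Ω →+* Ω) τ * (h₂ - hτα) + hττ - h₃
    rcases mul_eq_zero.1 h₄ with h₅ | h₅
    · exact Or.inl ⟨by linear_combination h₅, by linear_combination h₂ - hτα - h₅⟩
    · exact Or.inr ⟨by linear_combination h₅, by linear_combination h₂ - hτα - h₅⟩
  have hL (ρ : 𝓞 L) (g : Gal(Ω/L)) :
      mapRingHom ((g.restrictScalars F : Gal(Ω/F)) : Ω →+* Ω) (algebraMap (𝓞 L) (𝓞 Ω) ρ) =
        algebraMap (𝓞 L) (𝓞 Ω) ρ := RingOfIntegers.ext (g.commutes (ρ : L))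
  obtain ⟨n, hn⟩ := exists_ringOfIntegers_algebraMap_eq (k := L) (z := (N : 𝓞 Ω)) fun g => by
    rw [hN₁]
    exact hg (g.restrictScalars F) τ τ (hL t g)
  obtain ⟨n', hn'⟩ := exists_ringOfIntegers_algebraMap_eq (k := L)
      (z := ((N⁻¹ : (𝓞 Ω)ˣ) : 𝓞 Ω)) fun g => by
    rw [hN₂]
    exact hg (g.restrictScalars F) τ' τ' (hL (t⁻¹ : (𝓞 L)ˣ) g)
  obtain ⟨a', ha'⟩ := exists_ringOfIntegers_algebraMap_eq (k := F)
      (z := (N : 𝓞 Ω) + ((N⁻¹ : (𝓞 Ω)ˣ) : 𝓞 Ω)) fun g => by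
    rw [map_add, hN₁, hN₂]
    rcases hτ g with ⟨h₁, h₂⟩ | ⟨h₁, h₂⟩
    · rw [hg g _ _ h₁, hg g _ _ h₂]
    · rw [hg g _ _ h₁, hg g _ _ h₂, add_comm]
  have hnn : n * n' = 1 := ringOfIntegers_algebraMap_injective L Ω (by
    rw [map_mul, hn, hn', map_one, N.mul_inv])
  refine ⟨⟨n, n', hnn, (mul_comm _ _).trans hnn⟩, ⟨a', ?_⟩, ?_⟩
  · refine ringOfIntegers_algebraMap_injective L Ω ?_
    rw [hFL, ha', map_add]
    exact congrArg₂ (· + ·) hn hn'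
  · refine ringOfIntegers_dvd_of_algebraMap_dvd (Ω := Ω) ?_
    obtain ⟨c, hc⟩ := hN
    refine ⟨c, ?_⟩
    simp only [map_sub, map_add, map_one, map_mul, map_pow, map_natCast, hn, hFL, hc]
    change _ = (τ - 1) ^ 2 * c
    change 1 + (τ - 1) * (_ * ω) + (τ - 1) ^ 2 * c - (1 + _ * ω * (τ - 1)) = _
    ring

end Norm

/-! ### Definability of the integers -/

section Definability

open NumberField RingOfIntegers IntermediateField

/-- The traces `s_k = t ^ k + t⁻ᵏ` satisfy `s_{k+2} = a s_{k+1} - s_k`; hence the induction carries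
two consecutive terms. -/
theorem exists_pow_add_inv_pow_mem_range {F L : Type*} [Field F] [Field L] [Algebra F L]
    {t : (𝓞 L)ˣ} (ht : ∃ a : 𝓞 F, (t : 𝓞 L) + (t⁻¹ : (𝓞 L)ˣ) = algebraMap (𝓞 F) (𝓞 L) a) (k : ℕ) :
    ∃ a : 𝓞 F, ((t ^ k : (𝓞 L)ˣ) : 𝓞 L) + ((t ^ k)⁻¹ : (𝓞 L)ˣ) = algebraMap (𝓞 F) (𝓞 L) a := by
  obtain ⟨a, ha⟩ := ht
  have h := t.mul_inv
  suffices h : (∃ b : 𝓞 F, ((t ^ k : (𝓞 L)ˣ) : 𝓞 L) + ((t ^ k)⁻¹ : (𝓞 L)ˣ) =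
      algebraMap (𝓞 F) (𝓞 L) b) ∧ ∃ c : 𝓞 F, ((t ^ (k + 1) : (𝓞 L)ˣ) : 𝓞 L) +
        ((t ^ (k + 1))⁻¹ : (𝓞 L)ˣ) = algebraMap (𝓞 F) (𝓞 L) c from h.1
  simp only [← inv_pow, Units.val_pow_eq_pow_val]
  induction k with
  | zero => exact ⟨⟨2, by rw [map_ofNat, pow_zero, pow_zero]; norm_num⟩, ⟨a, by simpa using ha⟩⟩
  | succ k ih =>
    obtain ⟨⟨b, hb⟩, ⟨c, hc⟩⟩ := ih
    refine ⟨⟨c, hc⟩, ⟨a * c - b, ?_⟩⟩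
    rw [map_sub, map_mul, ← ha, ← hb, ← hc]
    simp only [pow_succ]
    linear_combination (-(t : 𝓞 L) ^ k - ((t⁻¹ : (𝓞 L)ˣ) : 𝓞 L) ^ k) * h

/-- A unit with trace `3` has infinite order. -/
theorem pow_ne_one_of_add_inv_eq_three {R : Type*} [CommRing R] [CharZero R] {t : Rˣ}
    (ht : (t : R) + (t⁻¹ : Rˣ) = 3) {k : ℕ} (hk : 0 < k) : t ^ k ≠ 1 := by
  have h := t.mul_inv
  -- The traces of powers are integers `2 < 3 < 7 < ⋯`, while `t ^ k = 1` would give trace `2`.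
  have key : ∀ k : ℕ, ∃ c d : ℤ, 2 ≤ c ∧ c < d ∧ (t : R) ^ k + ((t⁻¹ : Rˣ) : R) ^ k = c ∧
      (t : R) ^ (k + 1) + ((t⁻¹ : Rˣ) : R) ^ (k + 1) = d := by
    intro k
    induction k with
    | zero => exact ⟨2, 3, le_rfl, by norm_num, by norm_num, by simpa using ht⟩
    | succ k ih =>
      obtain ⟨c, d, h₁, h₂, h₃, h₄⟩ := ih
      refine ⟨d, 3 * d - c, by omega, by omega, h₄, ?_⟩
      push_cast
      rw [← ht, ← h₃, ← h₄]
      simp only [pow_succ]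
      linear_combination (-(t : R) ^ k - ((t⁻¹ : Rˣ) : R) ^ k) * h
  intro h₁
  obtain ⟨l, rfl⟩ := Nat.exists_eq_succ_of_ne_zero hk.ne'
  obtain ⟨c, d, hc, hcd, -, h₂⟩ := key l
  have h₃ : (t⁻¹) ^ (l + 1) = 1 := by rw [inv_pow, h₁, inv_one]
  rw [← Units.val_pow_eq_pow_val, ← Units.val_pow_eq_pow_val, h₁, h₃, Units.val_one] at h₂
  have : (2 : ℤ) = d := by
    have h₄ : ((2 : ℤ) : R) = (d : R) := by
      rw [← h₂]
      norm_num
    exact_mod_cast h₄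
  omega

theorem linearIndependent_int_pow {F L : Type*} [Field F] [NumberField F] [Field L] [Algebra F L]
    {w : 𝓞 F} {n : ℕ} (hn : n = (minpoly ℚ (w : F)).natDegree) :
    LinearIndependent ℤ fun i : Fin n => (algebraMap (𝓞 F) (𝓞 L) w) ^ (i : ℕ) := by
  subst hn
  have h : LinearIndependent ℤ fun i : Fin (minpoly ℚ (w : F)).natDegree => (w : F) ^ (i : ℕ) :=
    (linearIndependent_pow (K := ℚ) (w : F)).restrict_scalars' ℤ
  rw [Fintype.linearIndependent_iff] at h ⊢
  intro g hg
  refine h g ?_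
  have h₁ : ∑ i, g i • w ^ (i : ℕ) = 0 := ringOfIntegers_algebraMap_injective F L (by
    simpa [map_sum] using hg)
  simpa [map_sum] using congrArg (algebraMap (𝓞 F) F) h₁

variable {K : Type u} [Field K] [CharZero K] [Algebra.IsAlgebraic ℚ K]

/-- An element satisfying the formula cannot lie in a number field `F` whose degree exceeds the rank
of the unit group of an extension `L` that has a unit `t` of infinite order with `t + t⁻¹ ∈ F`. -/
theorem false_of_pellCongruence {p e : ℕ} (hp : p.Prime)
    (hK : ∀ F : IntermediateField ℚ K, FiniteDimensional ℚ F → ¬ p ^ e ∣ Module.finrank ℚ F)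
    {F : IntermediateField ℚ K} [NumberField F] {w : 𝓞 F} {n : ℕ}
    (hw : ∀ a, ∃ x y, PellCongruence (algebraMap (𝓞 F) (𝓞 K) w) a x y)
    (hn : n = (minpoly ℚ (w : F)).natDegree) {L : Type u} [Field L] [NumberField L] [Algebra F L]
    (hnL : Units.rank L < n) {t : (𝓞 L)ˣ}
    (ht : ∃ a : 𝓞 F, (t : 𝓞 L) + (t⁻¹ : (𝓞 L)ˣ) = algebraMap (𝓞 F) (𝓞 L) a)
    (ht' : ∀ k, 0 < k → t ^ k ≠ 1) : False := by
  refine false_of_units_one_add_mul (p := p) (e := e) hnL hp (linearIndependent_int_pow hn)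
    -- Having trace in `𝓞 F` is what allows the next unit's trace to be fed back into the formula.
    {t | ∃ a : 𝓞 F, (t : 𝓞 L) + (t⁻¹ : (𝓞 L)ˣ) = algebraMap (𝓞 F) (𝓞 L) a}
    (exists_pow_add_inv_pow_mem_range ht) ht' ?_
  rintro t ⟨a, ha⟩
  obtain ⟨x, y, hxy⟩ := hw (algebraMap (𝓞 F) (𝓞 K) a)
  let E : IntermediateField F K := IntermediateField.adjoin F {(x : K), (y : K)}
  have hE : FiniteDimensional F E := finiteDimensional_adjoin fun z _ =>
    (Algebra.IsAlgebraic.tower_top (K := ℚ) (A := K) F).isAlgebraic z |>.isIntegral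
  have hmem (z : 𝓞 K) (hz : (z : K) ∈ E) : ∃ z' : 𝓞 E, algebraMap (𝓞 E) (𝓞 K) z' = z :=
    ⟨⟨⟨z, hz⟩, (isIntegral_algebraMap_iff (algebraMap E K).injective).1 z.isIntegral_coe⟩, rfl⟩
  obtain ⟨x', hx'⟩ := hmem x (subset_adjoin _ _ (by simp))
  obtain ⟨y', hy'⟩ := hmem y (subset_adjoin _ _ (by simp))
  rw [← hx', ← hy'] at hxy
  have hFE (z : 𝓞 F) : algebraMap (𝓞 F) (𝓞 K) z =
      algebraMap (𝓞 E) (𝓞 K) (algebraMap (𝓞 F) (𝓞 E) z) :=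
    IsScalarTower.algebraMap_apply (𝓞 F) (𝓞 E) (𝓞 K) z
  have hxy' : PellCongruence (algebraMap (𝓞 F) (𝓞 E) w) (algebraMap (𝓞 F) (𝓞 E) a) x' y' := by
    refine ringOfIntegers_algebraMap_injective E K ?_
    unfold PellCongruence at hxy
    simpa only [map_add, map_sub, map_mul, map_pow, map_one, map_ofNat, ← hFE] using hxy
  have : Algebra.IsAlgebraic F (AlgebraicClosure L) := Algebra.IsAlgebraic.trans F L _
  obtain ⟨η, hη, h⟩ := exists_unit_of_pellCongruence (AlgebraicClosure L) hxy' ha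
  refine ⟨η, hη, Module.finrank F E, fun hdvd => ?_, h⟩
  have : FiniteDimensional ℚ E := Module.Finite.trans F E
  -- `[E : F]` divides `[E : ℚ]`, and `E` is a number field inside `K`.
  refine hK (E.restrictScalars ℚ) this (hdvd.trans ?_)
  exact ⟨Module.finrank ℚ F, by rw [mul_comm]; exact (Module.finrank_mul_finrank ℚ F E).symm⟩

/-- The rank is `r₁ + r₂ - 1`, the degree `r₁ + 2 r₂`. -/
theorem rank_lt_finrank (F : Type*) [Field F] [NumberField F] :
    Units.rank F < Module.finrank ℚ F := by
  have h₁ := InfinitePlace.card_add_two_mul_card_eq_rank F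
  have h₂ := InfinitePlace.card_eq_nrRealPlaces_add_nrComplexPlaces F
  have h₃ : 0 < Module.finrank ℚ F := Module.finrank_pos
  unfold Units.rank
  omega

theorem exists_unit_infinite_order {F : Type*} [Field F] [NumberField F] (h : 0 < Units.rank F) :
    ∃ t : (𝓞 F)ˣ, ∀ k, 0 < k → t ^ k ≠ 1 := by
  by_contra! ht
  rw [← Units.finrank_eq] at h
  refine h.ne' (Module.finrank_eq_zero_iff.2 fun t => ?_)
  obtain ⟨k, hk, hk'⟩ := ht t.toMul
  exact ⟨k, by exact_mod_cast hk.ne', by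
    rw [← ofMul_toMul t, ← ofMul_zpow, zpow_natCast, hk', ofMul_one]⟩

/-- A number field with finite unit group, other than `ℚ`, is imaginary quadratic, and has a
quadratic extension with unit rank one containing a unit of trace `3`. -/
theorem exists_unit_add_inv_eq_three {F : Type u} [Field F] [NumberField F]
    (h : Units.rank F = 0) (hF : 2 ≤ Module.finrank ℚ F) :
    ∃ (L : Type u) (_ : Field L) (_ : NumberField L) (_ : Algebra F L),
      Units.rank L < Module.finrank ℚ F ∧ ∃ t : (𝓞 L)ˣ, (t : 𝓞 L) + (t⁻¹ : (𝓞 L)ˣ) = 3 := by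
  have h₁ := InfinitePlace.card_add_two_mul_card_eq_rank F
  have h₂ := InfinitePlace.card_eq_nrRealPlaces_add_nrComplexPlaces F
  unfold Units.rank at h
  let f : Polynomial F := Polynomial.X ^ 2 - Polynomial.C 3 * Polynomial.X + 1
  have hf : f.natDegree = 2 := by
    simp only [f]
    compute_degree!
  have hfm : f.Monic := by
    simp only [f]
    monicity!
  obtain ⟨g, hg⟩ := IsAlgClosed.exists_aeval_eq_zero (AlgebraicClosure F) f
    (by rw [Polynomial.degree_eq_natDegree hfm.ne_zero, hf]; norm_num)
  have hgi : IsIntegral F g := ⟨f, hfm, hg⟩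
  have hg' : g * (3 - g) = 1 := by
    simp only [f, map_add, map_sub, map_mul, map_pow, Polynomial.aeval_X, map_one,
      map_ofNat] at hg
    linear_combination -hg
  let L := F⟮g⟯
  have hLF : Module.finrank F L ≤ 2 := by
    rw [IntermediateField.adjoin.finrank hgi, ← hf]
    exact Polynomial.natDegree_le_of_dvd (minpoly.dvd F g hg) hfm.ne_zero
  have : FiniteDimensional F L := IntermediateField.adjoin.finiteDimensional hgi
  have hL : NumberField L := NumberField.of_module_finite F L
  refine ⟨L, inferInstance, hL, inferInstance, ?_, ?_⟩
  · have h₃ := InfinitePlace.card_add_two_mul_card_eq_rank L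
    have h₄ := InfinitePlace.card_eq_nrRealPlaces_add_nrComplexPlaces L
    have h₅ : InfinitePlace.nrRealPlaces L = 0 := by
      -- Rank zero means `r₁ + r₂ = 1`, and degree at least `2` then forces `r₁ = 0`, `r₂ = 1`. So
      -- `L` is totally complex of degree at most `4`, with at most two infinite places.
      have h₆ : InfinitePlace.nrRealPlaces F = 0 := by omega
      rw [nrRealPlaces_eq_zero_iff] at h₆ ⊢
      exact isTotallyComplex_of_algebra F L
    have h₆ := Module.finrank_mul_finrank ℚ F L
    have h₇ : Module.finrank ℚ F = 2 := by omega
    rw [h₇] at h₆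
    unfold Units.rank
    omega
  · let γ : L := AdjoinSimple.gen F g
    have hγ : γ * (3 - γ) = 1 := (algebraMap L (AlgebraicClosure F)).injective (by
      rw [map_mul, map_sub, map_one, map_ofNat]
      exact hg')
    have hγi : IsIntegral ℤ γ := by
      refine ⟨Polynomial.X ^ 2 - 3 * Polynomial.X + 1, by monicity!, ?_⟩
      simp
      linear_combination -hγ
    have hγ' : (⟨γ, hγi⟩ : 𝓞 L) * (3 - ⟨γ, hγi⟩) = 1 := RingOfIntegers.ext hγ
    exact ⟨⟨⟨γ, hγi⟩, 3 - ⟨γ, hγi⟩, hγ', (mul_comm _ _).trans hγ'⟩, add_sub_cancel _ _⟩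

theorem mem_range_intCast_of_pellCongruence (hK : ¬ IsBigField K) {w : 𝓞 K}
    (hw : ∀ a, ∃ x y, PellCongruence w a x y) : w ∈ Set.range (Int.cast : ℤ → 𝓞 K) := by
  obtain ⟨p, e, hp, hpe⟩ := exists_prime_pow_not_dvd_finrank hK
  have hwi : IsIntegral ℚ (w : K) := w.isIntegral_coe.tower_top
  let F := ℚ⟮(w : K)⟯
  have : FiniteDimensional ℚ F := IntermediateField.adjoin.finiteDimensional hwi
  have : NumberField F := {}
  let γ : F := AdjoinSimple.gen ℚ (w : K)
  have hγi : IsIntegral ℤ γ :=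
    (isIntegral_algebraMap_iff (algebraMap F K).injective).1 w.isIntegral_coe
  let v : 𝓞 F := ⟨γ, hγi⟩
  have hv : algebraMap (𝓞 F) (𝓞 K) v = w := rfl
  have hdeg : Module.finrank ℚ F = (minpoly ℚ (v : F)).natDegree := by
    rw [IntermediateField.adjoin.finrank hwi]
    exact congrArg _ (minpoly.algebraMap_eq (algebraMap F K).injective γ)
  rw [← hv] at hw
  -- In degree one `w` is rational and integral. In higher degree `F` itself serves as `L` unless
  -- its unit rank is zero.
  by_cases hF : 2 ≤ Module.finrank ℚ F
  · exfalso
    rcases Nat.eq_zero_or_pos (Units.rank F) with h | h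
    · obtain ⟨L, _, _, _, hL, t, ht⟩ := exists_unit_add_inv_eq_three h hF
      exact false_of_pellCongruence hp hpe hw hdeg hL ⟨3, by rw [ht, map_ofNat]⟩
        fun k hk => pow_ne_one_of_add_inv_eq_three ht hk
    · obtain ⟨t, ht⟩ := exists_unit_infinite_order h
      exact false_of_pellCongruence hp hpe hw hdeg (rank_lt_finrank F) ⟨t + (t⁻¹ : (𝓞 F)ˣ), rfl⟩ ht
  · have h₁ : Module.finrank ℚ F = 1 := by
      have : 0 < Module.finrank ℚ F := Module.finrank_pos
      omega
    rw [IntermediateField.finrank_adjoin_simple_eq_one_iff, IntermediateField.mem_bot] at h₁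
    obtain ⟨q, hq⟩ := h₁
    have h₂ : IsIntegral ℤ q := by
      rw [← isIntegral_algebraMap_iff (algebraMap ℚ K).injective, hq]
      exact w.isIntegral_coe
    obtain ⟨m, rfl⟩ := IsIntegrallyClosed.isIntegral_iff.1 h₂
    exact ⟨m, RingOfIntegers.ext (by rw [← hq]; simp)⟩

end Definability

theorem theorem4p2 :
    -- one formula defines `ℤ` in the rings of integers of all non-big fields
    (∃ φ : Language.ring.Formula (Fin 1), IsForallForallExists φ ∧
      ∀ (K : Type u) [Field K] [CharZero K] [Algebra.IsAlgebraic ℚ K], ¬ IsBigField K →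
        ringDefinedSet (NumberField.RingOfIntegers K) φ =
          Set.range (Int.cast : ℤ → NumberField.RingOfIntegers K)) ∧
    -- number fields are non-big
    (∀ (K : Type u) [Field K] [NumberField K], ¬ IsBigField K) ∧
    -- the theories of these rings are undecidable
    (∀ (K : Type u) [Field K] [CharZero K] [Algebra.IsAlgebraic ℚ K], ¬ IsBigField K →
      ¬ IsDecidableTheory (ringTheory (NumberField.RingOfIntegers K))) ∧
    -- uniformly so: one computable list of sentences encodes one undecidable set in all of them
    (∃ (θ : ℕ → Language.ring.Sentence) (H : ℕ → Prop),
      Computable (fun n => ringFormulaCode (θ n)) ∧ ¬ ComputablePred H ∧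
      ∀ (K : Type u) [Field K] [CharZero K] [Algebra.IsAlgebraic ℚ K], ¬ IsBigField K →
        ∀ n : ℕ, θ n ∈ ringTheory (NumberField.RingOfIntegers K) ↔ H n) := by
  obtain ⟨φ, hφ, hφ'⟩ := exists_formula_pellCongruence.{u}
  have hdef : ∀ (K : Type u) [Field K] [CharZero K] [Algebra.IsAlgebraic ℚ K], ¬ IsBigField K →
      ringDefinedSet (NumberField.RingOfIntegers K) φ =
        Set.range (Int.cast : ℤ → NumberField.RingOfIntegers K) := by
    intro K _ _ _ hK
    rw [hφ']
    refine Set.Subset.antisymm (fun w hw => mem_range_intCast_of_pellCongruence hK hw) ?_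
    rintro _ ⟨m, rfl⟩ a
    exact exists_pellCongruence_intCast m a
  obtain ⟨θ, hθ, hθ'⟩ := exists_sentences_encoding_halts.{u} φ
  exact ⟨⟨φ, hφ, hdef⟩, not_isBigField_of_numberField,
    fun K _ _ _ hK => not_isDecidableTheory_of_encoding hθ not_computablePred_halts
      (hθ' _ (hdef K hK)),
    θ, Halts, hθ, not_computablePred_halts, fun K _ _ _ hK => hθ' _ (hdef K hK)⟩
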